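/- Theorem 1. Call a set of points in the plane in general position if no three of its points are collinear. A polygonal obstacle is the closed region bounded by a simple polygon. Given a finite set $P$ of points in the plane and finitely many polygonal obstacles such that the points of $P$ together with the vertices of the obstacles are in general position, the visibility graph has vertex set $P$, and two distinct points $p,q\in P$ are adjacent if and only if the closed segment $pq$ meets none of the obstacles. If this graph is isomorphic to $G$, the points and the obstacles form an obstacle representation of $G$; the obstacle number of $G$ is the smallest number of obstacles in an obstacle representation of $G$. Let $K^*_{5,5}$ be the graph obtained from the complete bipartite graph $K_{5,5}$ by removing the edges of a perfect matching; that is, its vertices are $b_1,\dots,b_5,r_1,\dots,r_5$ and its edges are exactly the pairs $b_ir_j$ with $i\neq j$. Then the obstacle number of $K^*_{5,5}$ is exactly $2$: it has an obstacle representation with two obstacles, and none with fewer. -/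

import Mathlib

/-- The Euclidean plane. -/
abbrev Plane : Type := EuclideanSpace ℝ (Fin 2)

/-- A set of points of the plane is in general position if no three of its (distinct) points
are collinear. -/
def InGeneralPosition (S : Set Plane) : Prop :=
  ∀ a ∈ S, ∀ b ∈ S, ∀ c ∈ S, a ≠ b → b ≠ c → a ≠ c → ¬ Collinear ℝ ({a, b, c} : Set Plane)

/-- A polygon is simple if it has at least three vertices, its vertices are pairwise distinct, and
two distinct edges meet at most in a common endpoint. The `i`-th edge is the closed segment from
the `i`-th vertex to the (cyclically) next one, which has index `finRotate n i`. -/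
structure IsSimplePolygon {n : ℕ} (p : Polygon Plane n) : Prop where
  three_le : 3 ≤ n
  injective : Function.Injective p.vertices
  edges_inter : ∀ i j : Fin n, i ≠ j →
    p.edgeSet ℝ i ∩ p.edgeSet ℝ j ⊆
      {p.vertices i, p.vertices (finRotate n i)} ∩ {p.vertices j, p.vertices (finRotate n j)}

/-- The closed region enclosed by a polygon: its boundary curve together with every point whose
connected component in the complement of the boundary curve is bounded. -/
def closedRegion {n : ℕ} (p : Polygon Plane n) : Set Plane :=
  p.boundary ℝ ∪
    {x | x ∉ p.boundary ℝ ∧ Bornology.IsBounded (connectedComponentIn (p.boundary ℝ)ᶜ x)}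

/-- A polygonal obstacle, given by a simple polygon. -/
structure PolygonalObstacle where
  /-- the number of vertices -/
  n : ℕ
  /-- the bounding polygon -/
  poly : Polygon Plane n
  simple : IsSimplePolygon poly

/-- The closed set of points that an obstacle occupies. -/
def PolygonalObstacle.region (O : PolygonalObstacle) : Set Plane :=
  closedRegion O.poly

/-- The set of vertices (corners) of an obstacle. -/
def PolygonalObstacle.corners (O : PolygonalObstacle) : Set Plane :=
  Set.range O.poly.vertices

/-- The visibility graph of a set of points among a family of obstacles: two distinct points
are adjacent iff the closed segment between them meets no obstacle. -/
def visibilityGraph {h : ℕ} (P : Set Plane) (obs : Fin h → PolygonalObstacle) :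
    SimpleGraph P where
  Adj x y := x ≠ y ∧ ∀ k : Fin h, Disjoint (segment ℝ (x : Plane) (y : Plane)) (obs k).region
  symm := ⟨fun x y hxy => ⟨hxy.1.symm, fun k => by
    rw [segment_symm]; exact hxy.2 k⟩⟩
  loopless := ⟨fun _ hx => hx.1 rfl⟩

/-- A finite set `P` of points and a family of `h` polygonal obstacles form an `h`-obstacle
representation of `G` if the points of `P` and the corners of the obstacles are together in
general position and the visibility graph is isomorphic to `G`. -/
def IsObstacleRepresentation {V : Type*} (G : SimpleGraph V) {h : ℕ}
    (P : Set Plane) (obs : Fin h → PolygonalObstacle) : Prop :=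
  P.Finite ∧ InGeneralPosition (P ∪ ⋃ k, (obs k).corners) ∧
    Nonempty (visibilityGraph P obs ≃g G)

/-- `G` has an `h`-obstacle representation. -/
def HasObstacleRepresentation {V : Type*} (G : SimpleGraph V) (h : ℕ) : Prop :=
  ∃ (P : Set Plane) (obs : Fin h → PolygonalObstacle), IsObstacleRepresentation G P obs

/-- The obstacle number of `G`: the smallest number of obstacles in an obstacle representation
of `G` (`⊤` if there is no representation). -/
noncomputable def obstacleNumber {V : Type*} (G : SimpleGraph V) : ℕ∞ :=
  ⨅ (h : ℕ) (_ : HasObstacleRepresentation G h), (h : ℕ∞)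

/-- `K*_{n,n}`: the complete bipartite graph `K_{n,n}` with the edges of a perfect matching
(joining equally indexed vertices) removed. -/
def kStar (n : ℕ) : SimpleGraph (Fin n ⊕ Fin n) :=
  (completeBipartiteGraph (Fin n) (Fin n)).deleteEdges
    (Set.range fun i : Fin n => s(Sum.inl i, Sum.inr i))

/-!
The obstacle number of `K*_{5,5}` is bounded from above by an explicit representation and from below
by a trapping argument.

**One obstacle does not suffice.** The region of an obstacle is connected
(`isPreconnected_closedRegion`), so it is enough that no connected set `O` avoids all edges of a
straight-line drawing of `K*_{5,5}` and meets all non-edges (`IsBlocked.elim`). The topological tool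
is `subset_openKite`: if `x` and `y` lie on different sides of the line `p q`, and `O` meets the
segment `p q` but none of the segments `p x`, `q x`, `p y`, `q y`, then `O` lies in the interior of
the quadrilateral formed by the two triangles `p q x` and `p q y`. It is used twice.

* With `p = r k`, `q = r l` and two points `b` as apexes it shows that the line through `r k`, `r l`
  has all three points `b i`, `i ≠ k, l`, on one side (`IsBlocked.same_side`). Hence all these `b i`
  see `r k`, `r l` in the same rotational order, which defines a tournament on the indices; it is
  transitive (`IsBlocked.precedes_trans`), so it is a linear order. By symmetry the points `b`
  are linearly ordered as well.
* Since there are five indices, they can be named `i, j, k, l, m` with `i` between `k` and `j` in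
  one order and between `l` and `m` in the other (`exists_between`). Then `b i` and `r i` fit into
  these orders like all other points (`IsBlocked.orient_matching`), so that the edges
  `b i r j` and `r i b l` cross on one side of the line `b i r i`, and `b i r k` and `r i b m` cross
  on the other side. The two crossings are the apexes of a kite over the non-edge `b i r i`, and
  `O` is trapped in it. But `O` also has to meet the non-edge `b i b l`, which is disjoint from the
  kite.

**Two obstacles suffice.** The points `b i` and `r i` form two convex chains bulging towards each
other, symmetric about the origin. The five segments `b i r i` pass through the origin and are
blocked by a small triangle. An arch-shaped polygon around the drawing pokes through all segments
within each chain. With integer coordinates, all conditions become sign conditions on determinants,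
which are checked by evaluation. The edges of the drawing avoid the two boundary curves, and they
are in the exterior because they are connected, avoiding the curves, to a half-plane below both
polygons.
-/

namespace KStar

/-! ### Orientation of triples of points -/

/-- Twice the signed area of the triangle `a b c`; it is positive if `a, b, c` are in
counterclockwise order and zero if they are collinear. -/
def orient (a b c : Plane) : ℝ :=
  (b 0 - a 0) * (c 1 - a 1) - (b 1 - a 1) * (c 0 - a 0)

lemma orient_rotate (a b c : Plane) : orient b c a = orient a b c := by
  simp only [orient]; ring

lemma orient_swap_left (a b c : Plane) : orient b a c = -orient a b c := by
  simp only [orient]; ring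

lemma orient_swap_right (a b c : Plane) : orient a c b = -orient a b c := by
  simp only [orient]; ring

@[simp] lemma orient_self_right (a b : Plane) : orient a b b = 0 := by
  simp only [orient]; ring

@[simp] lemma orient_self_left (a b : Plane) : orient a b a = 0 := by
  simp only [orient]; ring

lemma continuous_orient (a b : Plane) : Continuous (orient a b) := by
  unfold orient; fun_prop

lemma collinear_iff_orient_eq_zero (a b c : Plane) :
    Collinear ℝ ({a, b, c} : Set Plane) ↔ orient a b c = 0 := by
  constructor
  · intro h
    obtain ⟨v, hv⟩ := (collinear_iff_of_mem (p₀ := a) (by simp)).1 h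
    obtain ⟨s, rfl⟩ := hv b (by simp)
    obtain ⟨t, rfl⟩ := hv c (by simp)
    simp [orient]; ring
  · intro h
    by_cases hab : a = b
    · subst hab; simpa using collinear_pair ℝ a c
    have hn : (b 0 - a 0) ^ 2 + (b 1 - a 1) ^ 2 ≠ 0 := by
      intro h0
      apply hab
      have h1 : b 0 - a 0 = 0 := by nlinarith [sq_nonneg (b 0 - a 0), sq_nonneg (b 1 - a 1)]
      have h2 : b 1 - a 1 = 0 := by nlinarith [sq_nonneg (b 0 - a 0), sq_nonneg (b 1 - a 1)]
      ext i; fin_cases i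
      · simp; linarith
      · simp; linarith
    refine (collinear_iff_of_mem (p₀ := a) (by simp)).2 ⟨b - a, ?_⟩
    simp only [Set.mem_insert_iff, Set.mem_singleton_iff, forall_eq_or_imp, forall_eq]
    refine ⟨⟨0, by simp⟩, ⟨1, by simp⟩,
      ⟨((b 0 - a 0) * (c 0 - a 0) + (b 1 - a 1) * (c 1 - a 1)) /
        ((b 0 - a 0) ^ 2 + (b 1 - a 1) ^ 2), ?_⟩⟩
    simp only [orient] at h
    ext i; fin_cases i
    · simp; field_simp; linear_combination -(b 1 - a 1) * h
    · simp; field_simp; linear_combination (b 0 - a 0) * h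

/-- Along a segment the orientation with respect to a fixed pair is an affine function. -/
lemma orient_of_mem_segment (p q : Plane) {a b z : Plane} (hz : z ∈ segment ℝ a b) :
    ∃ s t : ℝ, 0 ≤ s ∧ 0 ≤ t ∧ s + t = 1 ∧ z = s • a + t • b ∧
      orient p q z = s * orient p q a + t * orient p q b := by
  obtain ⟨s, t, hs, ht, hst, rfl⟩ := hz
  refine ⟨s, t, hs, ht, hst, rfl, ?_⟩
  obtain rfl : s = 1 - t := by linarith
  simp [orient]; ring

/-- Barycentric coordinates with respect to the triangle `p q x`. -/
lemma orient_smul (p q x z : Plane) :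
    orient p q x • z = orient p q z • x + orient q x z • p + orient x p z • q := by
  ext i; fin_cases i <;> simp [orient] <;> ring

lemma orient_add (p q x z : Plane) :
    orient p q z + orient q x z + orient x p z = orient p q x := by
  simp only [orient]; ring

lemma mem_segment_of_smul {x y z : Plane} {s t H : ℝ} (hH : 0 < H) (hs : 0 ≤ s) (ht : 0 ≤ t)
    (hst : s + t = H) (h : H • z = s • x + t • y) : z ∈ segment ℝ x y := by
  refine ⟨s / H, t / H, by positivity, by positivity, by rw [← add_div, hst, div_self hH.ne'], ?_⟩
  have : z = H⁻¹ • (H • z) := by rw [smul_smul, inv_mul_cancel₀ hH.ne', one_smul]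
  rw [this, h, smul_add, smul_smul, smul_smul, div_eq_inv_mul, div_eq_inv_mul]

/-! ### Kites -/

/-- The open region formed by the two open triangles `p q x` and `p q y` together with the open
segment `p q` that they share; meaningful if `x` lies to the left and `y` to the right of the
directed line `p q`. -/
def openKite (p q x y : Plane) : Set Plane :=
  {z | (0 ≤ orient p q z → 0 < orient q x z ∧ 0 < orient x p z) ∧
    (orient p q z ≤ 0 → orient q y z < 0 ∧ orient y p z < 0)}

/-- The two closed triangles `p q x` and `p q y`. -/
def closedKite (p q x y : Plane) : Set Plane :=
  {z | 0 ≤ orient p q z ∧ 0 ≤ orient q x z ∧ 0 ≤ orient x p z} ∪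
    {z | orient p q z ≤ 0 ∧ orient q y z ≤ 0 ∧ orient y p z ≤ 0}

lemma isOpen_openKite (p q x y : Plane) : IsOpen (openKite p q x y) := by
  have h1 := continuous_orient p q
  have h2 := continuous_orient q x
  have h3 := continuous_orient x p
  have h4 := continuous_orient q y
  have h5 := continuous_orient y p
  have : openKite p q x y =
      ({z | orient p q z < 0} ∪ ({z | 0 < orient q x z} ∩ {z | 0 < orient x p z})) ∩
      ({z | 0 < orient p q z} ∪ ({z | orient q y z < 0} ∩ {z | orient y p z < 0})) := by
    ext z
    simp only [openKite, Set.mem_ofPred_eq, Set.mem_inter_iff, Set.mem_union, imp_iff_not_or,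
      not_le]
  rw [this]
  refine IsOpen.inter (IsOpen.union ?_ (IsOpen.inter ?_ ?_))
    (IsOpen.union ?_ (IsOpen.inter ?_ ?_))
  · exact isOpen_lt h1 continuous_const
  · exact isOpen_lt continuous_const h2
  · exact isOpen_lt continuous_const h3
  · exact isOpen_lt continuous_const h1
  · exact isOpen_lt h4 continuous_const
  · exact isOpen_lt h5 continuous_const

lemma isClosed_closedKite (p q x y : Plane) : IsClosed (closedKite p q x y) := by
  have h1 := continuous_orient p q
  have h2 := continuous_orient q x
  have h3 := continuous_orient x p
  have h4 := continuous_orient q y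
  have h5 := continuous_orient y p
  refine IsClosed.union ?_ ?_
  · exact (isClosed_le continuous_const h1).inter
      ((isClosed_le continuous_const h2).inter (isClosed_le continuous_const h3))
  · exact (isClosed_le h1 continuous_const).inter
      ((isClosed_le h4 continuous_const).inter (isClosed_le h5 continuous_const))

/-- The frontier of the kite consists of the four sides other than the common side `p q`. -/
lemma mem_sides_of_mem_closedKite {p q x y z : Plane} (hx : 0 < orient p q x)
    (hy : orient p q y < 0) (hz : z ∈ closedKite p q x y) (hz' : z ∉ openKite p q x y) :
    z ∈ segment ℝ p x ∪ segment ℝ q x ∪ (segment ℝ p y ∪ segment ℝ q y) := by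
  have ex := orient_smul p q x z
  have ey := orient_smul p q y z
  have sx := orient_add p q x z
  have sy := orient_add p q y z
  have ox : orient q x z = 0 → 0 ≤ orient p q z → 0 ≤ orient x p z → z ∈ segment ℝ q x := by
    intro h1 h2 h3
    refine mem_segment_of_smul hx h3 h2 (by linarith) ?_
    rw [ex, h1]; module
  have ox' : orient x p z = 0 → 0 ≤ orient p q z → 0 ≤ orient q x z → z ∈ segment ℝ p x := by
    intro h1 h2 h3
    refine mem_segment_of_smul hx h3 h2 (by linarith) ?_
    rw [ex, h1]; module
  have oy : orient q y z = 0 → orient p q z ≤ 0 → orient y p z ≤ 0 → z ∈ segment ℝ q y := by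
    intro h1 h2 h3
    refine mem_segment_of_smul (neg_pos.2 hy) (neg_nonneg.2 h3) (neg_nonneg.2 h2)
      (by linarith) ?_
    rw [neg_smul, ey, h1]; module
  have oy' : orient y p z = 0 → orient p q z ≤ 0 → orient q y z ≤ 0 → z ∈ segment ℝ p y := by
    intro h1 h2 h3
    refine mem_segment_of_smul (neg_pos.2 hy) (neg_nonneg.2 h3) (neg_nonneg.2 h2)
      (by linarith) ?_
    rw [neg_smul, ey, h1]; module
  -- On the line `p q` the coordinates with respect to the two triangles are proportional.
  have e1 : orient p q x * orient q y z - orient p q y * orient q x z =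
      orient p q z * (orient q y x) := by simp only [orient]; ring
  have e2 : orient p q x * orient y p z - orient p q y * orient x p z =
      orient p q z * (orient y p x) := by simp only [orient]; ring
  simp only [openKite, Set.mem_ofPred_eq, not_and_or, Classical.not_imp] at hz'
  simp only [Set.mem_union]
  rcases lt_trichotomy (orient p q z) 0 with h | h | h
  · obtain ⟨-, h4, h5⟩ : orient p q z ≤ 0 ∧ orient q y z ≤ 0 ∧ orient y p z ≤ 0 := by
      rcases hz with hz | hz
      · exact absurd hz.1 (not_le.2 h)
      · exact hz
    rcases hz' with hz' | ⟨-, hz' | hz'⟩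
    · exact absurd hz'.1 (not_le.2 h)
    · exact .inr (.inr (oy (le_antisymm h4 (not_lt.1 hz')) h.le h5))
    · exact .inr (.inl (oy' (le_antisymm h5 (not_lt.1 hz')) h.le h4))
  · rw [h, zero_mul] at e1 e2
    have hz3 : 0 ≤ orient q x z ∧ 0 ≤ orient x p z := by
      rcases hz with hz | ⟨-, h4, h5⟩
      · exact hz.2
      · constructor <;> by_contra! hc
        · nlinarith [mul_pos_of_neg_of_neg hy hc, mul_nonneg hx.le (neg_nonneg.2 h4)]
        · nlinarith [mul_pos_of_neg_of_neg hy hc, mul_nonneg hx.le (neg_nonneg.2 h5)]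
    by_cases hq : orient q x z = 0
    · exact .inl (.inr (ox hq h.ge hz3.2))
    by_cases hp : orient x p z = 0
    · exact .inl (.inl (ox' hp h.ge hz3.1))
    exfalso
    have h2 : 0 < orient q x z := lt_of_le_of_ne hz3.1 (Ne.symm hq)
    have h3 : 0 < orient x p z := lt_of_le_of_ne hz3.2 (Ne.symm hp)
    rcases hz' with ⟨-, hz' | hz'⟩ | ⟨-, hz' | hz'⟩
    · exact hz' h2
    · exact hz' h3
    · nlinarith [mul_neg_of_neg_of_pos hy h2, mul_nonneg hx.le (not_lt.1 hz')]
    · nlinarith [mul_neg_of_neg_of_pos hy h3, mul_nonneg hx.le (not_lt.1 hz')]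
  · obtain ⟨-, h4, h5⟩ : 0 ≤ orient p q z ∧ 0 ≤ orient q x z ∧ 0 ≤ orient x p z := by
      rcases hz with hz | hz
      · exact hz
      · exact absurd hz.1 (not_le.2 h)
    rcases hz' with ⟨-, hz' | hz'⟩ | hz'
    · exact .inl (.inr (ox (le_antisymm (not_lt.1 hz') h4) h.le h5))
    · exact .inl (.inl (ox' (le_antisymm (not_lt.1 hz') h5) h.le h4))
    · exact absurd hz'.1 (not_le.2 h)

/-- A connected set that meets the common side `p q` of a kite but none of the other four sides
is trapped inside the kite. -/
theorem subset_openKite {p q x y : Plane} (hx : 0 < orient p q x) (hy : orient p q y < 0)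
    {O : Set Plane} (hO : IsPreconnected O)
    (hpx : Disjoint (segment ℝ p x) O) (hqx : Disjoint (segment ℝ q x) O)
    (hpy : Disjoint (segment ℝ p y) O) (hqy : Disjoint (segment ℝ q y) O)
    (hpq : (segment ℝ p q ∩ O).Nonempty) : O ⊆ openKite p q x y := by
  have key : ∀ z ∈ O, z ∈ closedKite p q x y → z ∈ openKite p q x y := by
    intro z hz hk
    by_contra hn
    rcases mem_sides_of_mem_closedKite hx hy hk hn with (h | h) | h | h
    · exact hpx.ne_of_mem h hz rfl
    · exact hqx.ne_of_mem h hz rfl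
    · exact hpy.ne_of_mem h hz rfl
    · exact hqy.ne_of_mem h hz rfl
  refine hO.subset_left_of_subset_union (isOpen_openKite p q x y)
    (isClosed_closedKite p q x y).isOpen_compl ?_ ?_ ?_
  · rw [Set.disjoint_compl_right_iff_subset]
    intro z hz
    rcases le_total 0 (orient p q z) with h | h
    · exact .inl ⟨h, (hz.1 h).1.le, (hz.1 h).2.le⟩
    · exact .inr ⟨h, (hz.2 h).1.le, (hz.2 h).2.le⟩
  · intro z hz
    by_cases hk : z ∈ closedKite p q x y
    · exact .inl (key z hz hk)
    · exact .inr hk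
  · obtain ⟨z, hz, hzO⟩ := hpq
    refine ⟨z, hzO, key z hzO (.inl ?_)⟩
    obtain ⟨s, t, hs, ht, hst, rfl, -⟩ := orient_of_mem_segment p q hz
    obtain rfl : s = 1 - t := by linarith
    have e0 : orient p q ((1 - t) • p + t • q) = 0 := by simp [orient]; ring
    have e1 : orient q x ((1 - t) • p + t • q) = (1 - t) * orient p q x := by
      simp [orient]; ring
    have e2 : orient x p ((1 - t) • p + t • q) = t * orient p q x := by simp [orient]; ring
    refine ⟨e0.ge, ?_, ?_⟩
    · rw [e1]; positivity
    · rw [e2]; positivity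

/-! ### Crossing segments -/

/-- Two segments each of which separates the endpoints of the other cross. -/
lemma exists_mem_openSegment_of_mul_neg {a b c d : Plane}
    (h₁ : orient a b c * orient a b d < 0) (h₂ : orient c d a * orient c d b < 0) :
    ∃ x, x ∈ openSegment ℝ a b ∧ x ∈ openSegment ℝ c d := by
  have hw : ∀ A B : ℝ, A * B < 0 → A - B ≠ 0 ∧ 0 < -B / (A - B) ∧ 0 < A / (A - B) := by
    intro A B h
    rcases mul_neg_iff.1 h with ⟨hA, hB⟩ | ⟨hA, hB⟩
    · exact ⟨by linarith, div_pos (by linarith) (by linarith), div_pos hA (by linarith)⟩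
    · exact ⟨by linarith, div_pos_of_neg_of_neg (by linarith) (by linarith),
        div_pos_of_neg_of_neg hA (by linarith)⟩
  obtain ⟨n₁, p₁, q₁⟩ := hw _ _ h₂
  obtain ⟨n₂, p₂, q₂⟩ := hw _ _ h₁
  refine ⟨_, ⟨_, _, p₁, q₁, by rw [← add_div, neg_add_eq_sub, div_self n₁], rfl⟩,
    ⟨_, _, p₂, q₂, by rw [← add_div, neg_add_eq_sub, div_self n₂], ?_⟩⟩
  have e : orient a b c - orient a b d = -(orient c d a - orient c d b) := by
    simp only [orient]; ring
  rw [e]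
  generalize hN : orient c d a - orient c d b = N at *
  simp only [orient] at *
  ext i; fin_cases i
  · simp; field_simp; ring
  · simp; field_simp; ring

/-! ### Connected sets blocking the non-edges of the graph -/

/-- `O` is a connected set that blocks exactly the non-edges of `K*_{5,5}`, drawn with the points
`b i` and `r i` as vertices. Of the general position of these points only the triples that contain
points of both classes are recorded. -/
structure IsBlocked (b r : Fin 5 → Plane) (O : Set Plane) : Prop where
  isPreconnected : IsPreconnected O
  disjoint : ∀ i j, i ≠ j → Disjoint (segment ℝ (b i) (r j)) O
  meets_left : ∀ i j, i ≠ j → (segment ℝ (b i) (b j) ∩ O).Nonempty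
  meets_right : ∀ i j, i ≠ j → (segment ℝ (r i) (r j) ∩ O).Nonempty
  meets_matching : ∀ i, (segment ℝ (b i) (r i) ∩ O).Nonempty
  orient_left : ∀ i j k, i ≠ j → orient (b i) (b j) (r k) ≠ 0
  orient_right : ∀ i j k, i ≠ j → orient (r i) (r j) (b k) ≠ 0

/-- `r l` follows `r k` in the counterclockwise order in which the points `r` are seen from every
`b i` whose index differs from both `k` and `l`. -/
def Precedes (b r : Fin 5 → Plane) (k l : Fin 5) : Prop :=
  ∀ i, i ≠ k → i ≠ l → 0 < orient (b i) (r k) (r l)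

namespace IsBlocked

variable {b r : Fin 5 → Plane} {O : Set Plane}

lemma symm (h : IsBlocked b r O) : IsBlocked r b O where
  isPreconnected := h.isPreconnected
  disjoint i j hij := by rw [segment_symm]; exact h.disjoint j i hij.symm
  meets_left := h.meets_right
  meets_right := h.meets_left
  meets_matching i := by rw [segment_symm]; exact h.meets_matching i
  orient_left := h.orient_right
  orient_right := h.orient_left

/-- If the line `r k`, `r l` had `b i` and `b m` on one side and `b j` on the other, then `O` would
be trapped in two kites, and on that one side the two triangles cannot share a point of the
segment from `b i` to `b m`. -/
lemma not_two_one (h : IsBlocked b r O) {i j k l m : Fin 5} (hkl : k ≠ l) (him : i ≠ m)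
    (hi : i ≠ k ∧ i ≠ l) (hj : j ≠ k ∧ j ≠ l) (hm : m ≠ k ∧ m ≠ l)
    (pi : 0 < orient (r k) (r l) (b i)) (pm : 0 < orient (r k) (r l) (b m))
    (pj : orient (r k) (r l) (b j) < 0) : False := by
  have trap : ∀ i, i ≠ k ∧ i ≠ l → 0 < orient (r k) (r l) (b i) →
      O ⊆ openKite (r k) (r l) (b i) (b j) := fun i hi pi =>
    subset_openKite pi pj h.isPreconnected (h.symm.disjoint _ _ hi.1.symm)
      (h.symm.disjoint _ _ hi.2.symm) (h.symm.disjoint _ _ hj.1.symm)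
      (h.symm.disjoint _ _ hj.2.symm) (h.meets_right k l hkl)
  obtain ⟨z, hz, hzO⟩ := h.meets_left i m him
  obtain ⟨s, t, hs, ht, hst, -, e⟩ := orient_of_mem_segment (r k) (r l) hz
  have pz : 0 ≤ orient (r k) (r l) z := by rw [e]; positivity
  have h1 := ((trap i hi pi hzO).1 pz).2
  have h2 := ((trap m hm pm hzO).1 pz).2
  obtain ⟨s, t, hs, ht, hst, -, e⟩ := orient_of_mem_segment (r k) z hz
  rw [orient_self_right, ← orient_rotate, ← orient_rotate z, orient_rotate, orient_rotate] at e
  rw [← orient_rotate] at h1 h2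
  rcases hs.eq_or_lt with rfl | hs
  · obtain rfl : t = 1 := by linarith
    linarith
  · nlinarith [mul_pos hs h1, mul_nonneg ht h2.le]

/-- All the points `b i`, `i ≠ k, l`, lie on the same side of the line through `r k`, `r l`. -/
lemma same_side (h : IsBlocked b r O) {i j k l : Fin 5} (hkl : k ≠ l)
    (hi : i ≠ k ∧ i ≠ l) (hj : j ≠ k ∧ j ≠ l)
    (pi : 0 < orient (r k) (r l) (b i)) : 0 < orient (r k) (r l) (b j) := by
  by_contra hc
  have pj : orient (r k) (r l) (b j) < 0 :=
    lt_of_le_of_ne (not_lt.1 hc) (h.orient_right k l j hkl)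
  obtain ⟨m, hmi, hmj, hmk, hml⟩ : ∃ m : Fin 5, m ≠ i ∧ m ≠ j ∧ m ≠ k ∧ m ≠ l := by
    clear * -; revert i j k l; decide
  rcases (h.orient_right k l m hkl).lt_or_gt with pm | pm
  · refine h.not_two_one hkl.symm hmj.symm hj.symm hi.symm ⟨hml, hmk⟩ ?_ ?_ ?_ <;>
      rw [orient_swap_left] <;> linarith
  · exact h.not_two_one hkl hmi.symm hi hj ⟨hmk, hml⟩ pi pm pj

lemma precedes_total (h : IsBlocked b r O) {k l : Fin 5} (hkl : k ≠ l) :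
    Precedes b r k l ∨ Precedes b r l k := by
  obtain ⟨i, hik, hil⟩ : ∃ i : Fin 5, i ≠ k ∧ i ≠ l := by revert k l; decide
  rcases (h.orient_right k l i hkl).lt_or_gt with p | p
  · right
    intro j hj hj'
    rw [← orient_rotate]
    refine h.same_side hkl.symm ⟨hil, hik⟩ ⟨hj, hj'⟩ ?_
    rw [orient_swap_left]; linarith
  · left
    intro j hj hj'
    rw [← orient_rotate]
    exact h.same_side hkl ⟨hik, hil⟩ ⟨hj, hj'⟩ p

lemma precedes_asymm {k l : Fin 5} (h₁ : Precedes b r k l) : ¬ Precedes b r l k := by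
  intro h₂
  obtain ⟨i, hik, hil⟩ : ∃ i : Fin 5, i ≠ k ∧ i ≠ l := by
    clear h₁ h₂; revert k l; decide
  have := h₁ i hik hil
  have := h₂ i hil hik
  rw [orient_swap_right] at this
  linarith

/-- If three points `r` were in cyclic order, then the two points `b` with the other two indices
would lie in the triangle that they span, and the line through these two points `b` would
separate the three points `r`. -/
lemma precedes_trans (h : IsBlocked b r O) {k l m : Fin 5} (hkl : Precedes b r k l)
    (hlm : Precedes b r l m) : Precedes b r k m := by
  have hkm : k ≠ m := by rintro rfl; exact precedes_asymm hkl hlm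
  rcases h.precedes_total hkm with hc | hmk
  · exact hc
  exfalso
  obtain ⟨i, j, hij, ⟨hik, hil, him⟩, hjk, hjl, hjm⟩ : ∃ i j : Fin 5, i ≠ j ∧
      (i ≠ k ∧ i ≠ l ∧ i ≠ m) ∧ j ≠ k ∧ j ≠ l ∧ j ≠ m := by
    clear hkl hlm hmk hkm; revert k l m; decide
  have p1 := hkl i hik hil
  have p2 := hlm i hil him
  have p3 := hmk i him hik
  have e : orient (b i) (b j) (r k) * orient (b i) (r l) (r m) +
      orient (b i) (b j) (r l) * orient (b i) (r m) (r k) +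
      orient (b i) (b j) (r m) * orient (b i) (r k) (r l) = 0 := by
    simp only [orient]; ring
  rcases (h.orient_left i j k hij).lt_or_gt with q | q
  · have side : ∀ x, x ≠ i → x ≠ j → orient (b i) (b j) (r x) < 0 := by
      intro x hx hx'
      have := h.symm.same_side (i := k) (j := x) hij.symm ⟨hjk.symm, hik.symm⟩ ⟨hx', hx⟩
        (by rw [orient_swap_left]; linarith)
      rw [orient_swap_left] at this; linarith
    nlinarith [mul_neg_of_neg_of_pos (side k hik.symm hjk.symm) p2,
      mul_neg_of_neg_of_pos (side l hil.symm hjl.symm) p3,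
      mul_neg_of_neg_of_pos (side m him.symm hjm.symm) p1]
  · have side : ∀ x, x ≠ i → x ≠ j → 0 < orient (b i) (b j) (r x) := fun x hx hx' =>
      h.symm.same_side (i := k) (j := x) hij ⟨hik.symm, hjk.symm⟩ ⟨hx, hx'⟩ q
    nlinarith [mul_pos (side k hik.symm hjk.symm) p2,
      mul_pos (side l hil.symm hjl.symm) p3, mul_pos (side m him.symm hjm.symm) p1]

/-- The order of the points `r` is given by a permutation of the indices. -/
lemma exists_perm (h : IsBlocked b r O) :
    ∃ σ : Equiv.Perm (Fin 5), ∀ k l, σ k < σ l → Precedes b r k l := by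
  classical
  have hsto : IsStrictTotalOrder (Fin 5) (fun k l => k ≠ l ∧ Precedes b r k l) :=
    { irrefl := fun k hk => hk.1 rfl
      trichotomous := fun k l h₁ h₂ => by
        by_contra hkl
        rcases h.precedes_total hkl with hp | hp
        · exact h₁ ⟨hkl, hp⟩
        · exact h₂ ⟨Ne.symm hkl, hp⟩
      trans := fun k l m h₁ h₂ => by
        refine ⟨?_, h.precedes_trans h₁.2 h₂.2⟩
        rintro rfl
        exact precedes_asymm h₁.2 h₂.2 }
  have order : ∀ (α : Type) [LinearOrder α] [Fintype α] (_ : Fintype.card α = 5),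
      ∃ e : α ≃ Fin 5, ∀ k l, e k < e l → k < l := fun α _ _ hα =>
    ⟨(Fintype.orderIsoFinOfCardEq α hα).symm.toEquiv, fun k l hkl => by
      simpa using hkl⟩
  obtain ⟨e, he⟩ := @order (Fin 5) (linearOrderOfSTO fun k l => k ≠ l ∧ Precedes b r k l) _
    (Fintype.card_fin 5)
  exact ⟨e, fun k l hkl => (he k l hkl).2⟩

end IsBlocked

/-- Given two linear orders on five elements, the elements can be named `i, j, k, l, m` such that
`i` lies between `k` and `j` in the first order and between `l` and `m` in the second one. -/
lemma exists_between (σ τ : Equiv.Perm (Fin 5)) : ∃ i j k l m : Fin 5,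
    [i, j, k, l, m].Nodup ∧ σ k < σ i ∧ σ i < σ j ∧ τ l < τ i ∧ τ i < τ m := by
  have key : ∀ π : Equiv.Perm (Fin 5), ∃ i j, i < j ∧ ∃ k < i, ∃ l, π l < π i ∧
      ∃ m, π i < π m ∧ [i, j, k, l, m].Nodup := by
    decide +kernel
  obtain ⟨i, j, h1, k, h2, l, h3, m, h4, h5⟩ := key (σ.symm.trans τ)
  refine ⟨σ.symm i, σ.symm j, σ.symm k, σ.symm l, σ.symm m, ?_, by simpa, by simpa, h3, h4⟩
  simpa using h5.map σ.symm.injective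

/-- If the three directions from `a` to `u`, `v`, `w` are in counterclockwise order, and `u` and
`w` lie to the left of a directed line `c a`, then so does `v`. -/
lemma orient_pos_of_cone {a c u v w : Plane} (huv : 0 < orient a u v) (hvw : 0 < orient a v w)
    (huw : 0 < orient a u w) (hu : 0 < orient c a u) (hw : 0 < orient c a w) :
    0 < orient c a v := by
  have e : orient c a v * orient a u w =
      orient c a u * orient a v w + orient c a w * orient a u v := by
    simp only [orient]; ring
  exact pos_of_mul_pos_left (e ▸ by positivity) huw.le

/-- A variant of `orient_pos_of_cone` for the reversed line. -/
lemma orient_pos_of_cone' {a c u v w : Plane} (huv : 0 < orient a u v) (hvw : 0 < orient a v w)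
    (huw : 0 < orient a u w) (hu : 0 < orient a c u) (hw : 0 < orient a c w) :
    0 < orient a c v := by
  have e : orient a c v * orient a u w =
      orient a c u * orient a v w + orient a c w * orient a u v := by
    simp only [orient]; ring
  exact pos_of_mul_pos_left (e ▸ by positivity) huw.le

namespace IsBlocked

variable {b r : Fin 5 → Plane} {O : Set Plane}

/-- The point `b i`, which lies between `b l` and `b m` as seen from `r j` and `r k`, sees
`r k`, `r i`, `r j` in the same order as the other points `b` do. -/
lemma orient_matching (h : IsBlocked b r O) {i j k l m : Fin 5} (hn : [i, j, k, l, m].Nodup)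
    (hki : Precedes b r k i) (hij : Precedes b r i j) (hli : Precedes r b l i)
    (him : Precedes r b i m) :
    0 < orient (b i) (r i) (r j) ∧ 0 < orient (b i) (r k) (r i) := by
  simp only [List.nodup_cons, List.mem_cons, List.not_mem_nil, not_or, or_false] at hn
  obtain ⟨⟨nij, nik, nil, nim⟩, ⟨njk, njl, njm⟩, ⟨nkl, nkm⟩, nlm, -⟩ := hn
  have hlm := h.symm.precedes_trans hli him
  constructor
  · rw [← orient_rotate]
    refine orient_pos_of_cone (hli j njl (Ne.symm nij)) (him j (Ne.symm nij) njm)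
      (hlm j njl njm) ?_ ?_ <;> rw [orient_rotate]
    · exact hij l (Ne.symm nil) (Ne.symm njl)
    · exact hij m (Ne.symm nim) (Ne.symm njm)
  · rw [← orient_rotate]
    refine orient_pos_of_cone' (hli k nkl (Ne.symm nik)) (him k (Ne.symm nik) nkm)
      (hlm k nkl nkm) ?_ ?_ <;> rw [orient_rotate]
    · exact hki l (Ne.symm nkl) (Ne.symm nil)
    · exact hki m (Ne.symm nkm) (Ne.symm nim)

/-- No connected set blocks exactly the non-edges of a drawing of `K*_{5,5}`. -/
theorem elim (h : IsBlocked b r O) : False := by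
  obtain ⟨σ, hσ⟩ := h.exists_perm
  obtain ⟨τ, hτ⟩ := h.symm.exists_perm
  obtain ⟨i, j, k, l, m, hn, hki, hij, hli, him⟩ := exists_between σ τ
  replace hki := hσ _ _ hki
  replace hij := hσ _ _ hij
  replace hli := hτ _ _ hli
  replace him := hτ _ _ him
  obtain ⟨pj, pk⟩ := h.orient_matching hn hki hij hli him
  have hn' : [i, m, l, k, j].Nodup := by
    simp only [List.nodup_cons, List.mem_cons, List.not_mem_nil, not_or, or_false] at hn ⊢
    grind
  obtain ⟨pm, pl⟩ := h.symm.orient_matching hn' hli him hki hij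
  simp only [List.nodup_cons, List.mem_cons, List.not_mem_nil, not_or, or_false] at hn
  obtain ⟨⟨nij, nik, nil, nim⟩, ⟨njk, njl, njm⟩, ⟨nkl, nkm⟩, nlm, -⟩ := hn
  have q1 := hli j njl (Ne.symm nij)
  have q2 := hij l (Ne.symm nil) (Ne.symm njl)
  have q3 := him k (Ne.symm nik) nkm
  have q4 := hki m (Ne.symm nkm) (Ne.symm nim)
  -- The two kite apexes: crossing points of edges at `b i` with edges at `r i`.
  obtain ⟨x, hx, hx'⟩ : ∃ x, x ∈ openSegment ℝ (b i) (r j) ∧ x ∈ openSegment ℝ (r i) (b l) := by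
    apply exists_mem_openSegment_of_mul_neg
    · rw [orient_swap_right (b i) (r i) (r j), ← orient_rotate (b i) (r j) (b l)]
      nlinarith [mul_pos pj q1]
    · rw [← orient_rotate (r i) (b l) (r j), orient_swap_right (b l)]
      nlinarith [mul_pos pl q2]
  obtain ⟨y, hy, hy'⟩ : ∃ y, y ∈ openSegment ℝ (b i) (r k) ∧ y ∈ openSegment ℝ (r i) (b m) := by
    apply exists_mem_openSegment_of_mul_neg
    · rw [orient_swap_left (r k) (b i) (b m)]
      nlinarith [mul_pos pk q3]
    · rw [← orient_rotate (r i) (b m) (r k), orient_swap_right (r i)]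
      nlinarith [mul_pos pm q4]
  obtain ⟨s, u, hs, hu, hsu, rfl⟩ := hx
  obtain ⟨s', u', hs', hu', hsu', rfl⟩ := hy
  obtain rfl : s = 1 - u := by linarith
  obtain rfl : s' = 1 - u' := by linarith
  have ex : orient (b i) (r i) ((1 - u) • b i + u • r j) = u * orient (b i) (r i) (r j) := by
    simp [orient]; ring
  have ey : orient (b i) (r i) ((1 - u') • b i + u' • r k) =
      -(u' * orient (b i) (r k) (r i)) := by
    simp [orient]; ring
  have sub : ∀ {p q z : Plane}, z ∈ segment ℝ p q → segment ℝ p z ⊆ segment ℝ p q :=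
    fun hz => (convex_segment _ _).segment_subset (left_mem_segment ℝ _ _) hz
  have trap : O ⊆ openKite (b i) (r i) ((1 - u) • b i + u • r j)
      ((1 - u') • b i + u' • r k) := by
    refine subset_openKite (by rw [ex]; positivity) (by rw [ey]; nlinarith [mul_pos hu' pk])
      h.isPreconnected ?_ ?_ ?_ ?_ (h.meets_matching i)
    · exact (h.disjoint i j nij).mono_left
        (sub ⟨_, _, hs.le, hu.le, hsu, rfl⟩)
    · exact (h.symm.disjoint i l nil).mono_left (sub (openSegment_subset_segment _ _ _ hx'))
    · exact (h.disjoint i k nik).mono_left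
        (sub ⟨_, _, hs'.le, hu'.le, hsu', rfl⟩)
    · exact (h.symm.disjoint i m nim).mono_left (sub (openSegment_subset_segment _ _ _ hy'))
  -- The segment from `b i` to `b l` leaves `b i` outside of the kite.
  obtain ⟨z, hz, hzO⟩ := h.meets_left i l nil
  obtain ⟨s, t, hs, ht, hst, rfl⟩ := hz
  obtain rfl : s = 1 - t := by linarith
  have e1 : orient (b i) (r i) ((1 - t) • b i + t • b l) = t * orient (r i) (b l) (b i) := by
    simp [orient]; ring
  have e2 : orient ((1 - u) • b i + u • r j) (b i) ((1 - t) • b i + t • b l) =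
      -(u * t * orient (r j) (b l) (b i)) := by
    simp [orient]; ring
  have := ((trap hzO).1 (by rw [e1]; positivity)).2
  rw [e2] at this
  have : 0 ≤ u * t * orient (r j) (b l) (b i) := by positivity
  linarith

end IsBlocked

/-! ### The closed region of a polygon -/

lemma edgeSet_eq_segment {n : ℕ} (p : Polygon Plane n) (i : Fin n) :
    p.edgeSet ℝ i = segment ℝ (p.vertices i) (p.vertices (finRotate n i)) :=
  affineSegment_eq_segment ℝ _ _

lemma isPreconnected_edgeSet {n : ℕ} (p : Polygon Plane n) (i : Fin n) :
    IsPreconnected (p.edgeSet ℝ i) := by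
  rw [edgeSet_eq_segment]; exact (convex_segment _ _).isPreconnected

lemma isPreconnected_boundary {n : ℕ} (p : Polygon Plane n) : IsPreconnected (p.boundary ℝ) := by
  rcases n with _ | n
  · simp [Polygon.boundary, isPreconnected_empty]
  refine IsPreconnected.iUnion_of_chain (isPreconnected_edgeSet p) fun i => ?_
  refine Fin.lastCases ?_ (fun i => ?_) i
  · rw [Fin.orderSucc_last, Set.inter_self, edgeSet_eq_segment]
    exact ⟨_, left_mem_segment ℝ _ _⟩
  · rw [Fin.orderSucc_castSucc, edgeSet_eq_segment, edgeSet_eq_segment]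
    refine ⟨p.vertices i.succ, ?_, left_mem_segment ℝ _ _⟩
    rw [finRotate_apply, Fin.coeSucc_eq_succ]
    exact right_mem_segment ℝ _ _

lemma isClosed_boundary {n : ℕ} (p : Polygon Plane n) : IsClosed (p.boundary ℝ) := by
  refine isClosed_iUnion_of_finite fun i => ?_
  rw [Polygon.edgeSet_eq_image_edgePath]
  exact (isCompact_Icc.image (AffineMap.continuous_of_finiteDimensional _)).isClosed

/-- A bounded component of the complement of a closed set has a limit point in that set. -/
lemma exists_mem_closure_connectedComponentIn {F : Set Plane} (hF : IsClosed F) {x : Plane}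
    (hx : x ∉ F) (hb : Bornology.IsBounded (connectedComponentIn Fᶜ x)) :
    ∃ y ∈ F, y ∈ closure (connectedComponentIn Fᶜ x) := by
  have hxC := mem_connectedComponentIn (F := Fᶜ) hx
  have hne : connectedComponentIn Fᶜ x ≠ Set.univ := fun h =>
    NormedSpace.unbounded_univ ℝ Plane (h ▸ hb)
  obtain ⟨y, hy⟩ := nonempty_frontier_iff.2 ⟨⟨x, hxC⟩, hne⟩
  rw [(hF.isOpen_compl.connectedComponentIn).frontier_eq] at hy
  refine ⟨y, ?_, hy.1⟩
  by_contra hyF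
  obtain ⟨z, hzy, hzx⟩ := mem_closure_iff.1 hy.1 _ hF.isOpen_compl.connectedComponentIn
    (mem_connectedComponentIn (F := Fᶜ) hyF)
  apply hy.2
  rw [connectedComponentIn_eq hzx, ← connectedComponentIn_eq hzy]
  exact mem_connectedComponentIn hyF

theorem isPreconnected_closedRegion {n : ℕ} (p : Polygon Plane n) :
    IsPreconnected (closedRegion p) := by
  have hF := isClosed_boundary p
  rcases (p.boundary ℝ).eq_empty_or_nonempty with h0 | ⟨w, hw⟩
  · have : closedRegion p = ∅ := by
      rw [closedRegion, h0, Set.empty_union, Set.eq_empty_iff_forall_notMem]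
      rintro x ⟨-, hb⟩
      rw [Set.compl_empty, isPreconnected_univ.connectedComponentIn (Set.mem_univ x)] at hb
      exact NormedSpace.unbounded_univ ℝ Plane hb
    rw [this]; exact isPreconnected_empty
  refine isPreconnected_of_forall w fun x hx => ?_
  rcases hx with hx | ⟨hx, hb⟩
  · exact ⟨_, Set.subset_union_left, hw, hx, isPreconnected_boundary p⟩
  obtain ⟨y, hyF, hyC⟩ := exists_mem_closure_connectedComponentIn hF hx hb
  refine ⟨p.boundary ℝ ∪ insert y (connectedComponentIn (p.boundary ℝ)ᶜ x), ?_, .inl hw,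
    .inr (.inr (mem_connectedComponentIn hx)), ?_⟩
  · rintro z (hz | rfl | hz)
    · exact .inl hz
    · exact .inl hyF
    · refine .inr ⟨connectedComponentIn_subset _ _ hz, ?_⟩
      rwa [← connectedComponentIn_eq hz]
  · refine (isPreconnected_boundary p).union y hyF (Set.mem_insert _ _) ?_
    exact isPreconnected_connectedComponentIn.subset_closure (Set.subset_insert _ _)
      (Set.insert_subset hyC subset_closure)

/-! ### One obstacle does not suffice -/

@[simp] lemma kStar_adj_inl_inr (n : ℕ) (i j : Fin n) :
    (kStar n).Adj (Sum.inl i) (Sum.inr j) ↔ i ≠ j := by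
  simp [kStar, eq_comm]

@[simp] lemma kStar_adj_inr_inl (n : ℕ) (i j : Fin n) :
    (kStar n).Adj (Sum.inr i) (Sum.inl j) ↔ i ≠ j := by
  rw [SimpleGraph.adj_comm, kStar_adj_inl_inr, ne_comm]

@[simp] lemma not_kStar_adj_inl_inl (n : ℕ) (i j : Fin n) :
    ¬ (kStar n).Adj (Sum.inl i) (Sum.inl j) := by
  simp [kStar]

@[simp] lemma not_kStar_adj_inr_inr (n : ℕ) (i j : Fin n) :
    ¬ (kStar n).Adj (Sum.inr i) (Sum.inr j) := by
  simp [kStar]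

theorem not_hasObstacleRepresentation_zero : ¬ HasObstacleRepresentation (kStar 5) 0 := by
  rintro ⟨P, obs, -, -, ⟨e⟩⟩
  have : (visibilityGraph P obs).Adj (e.symm (Sum.inl 0)) (e.symm (Sum.inl 1)) :=
    ⟨by simp, fun k => k.elim0⟩
  simpa using e.map_adj_iff.2 this

theorem not_hasObstacleRepresentation_one : ¬ HasObstacleRepresentation (kStar 5) 1 := by
  rintro ⟨P, obs, -, hgp, ⟨e⟩⟩
  have inj : ∀ u v, u ≠ v → (e.symm u : Plane) ≠ e.symm v := fun u v huv h =>
    huv (e.symm.injective (Subtype.coe_injective h))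
  have adj : ∀ u v, (kStar 5).Adj u v →
      Disjoint (segment ℝ (e.symm u : Plane) (e.symm v)) (obs 0).region := fun u v huv =>
    (e.symm.map_adj_iff.2 huv).2 0
  have nadj : ∀ u v, u ≠ v → ¬ (kStar 5).Adj u v →
      (segment ℝ (e.symm u : Plane) (e.symm v) ∩ (obs 0).region).Nonempty := by
    intro u v huv h
    rw [← Set.not_disjoint_iff_nonempty_inter]
    intro hd
    apply h
    refine e.symm.map_adj_iff.1 ⟨fun h => inj u v huv (congrArg _ h), fun k => ?_⟩
    rwa [Subsingleton.elim k 0]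
  have gp : ∀ u v w, u ≠ v → v ≠ w → u ≠ w →
      orient (e.symm u) (e.symm v) (e.symm w) ≠ 0 := by
    intro u v w huv hvw huw h
    exact hgp _ (.inl (e.symm u).2) _ (.inl (e.symm v).2) _ (.inl (e.symm w).2) (inj _ _ huv)
      (inj _ _ hvw) (inj _ _ huw) ((collinear_iff_orient_eq_zero _ _ _).2 h)
  refine IsBlocked.elim (b := fun i => e.symm (Sum.inl i)) (r := fun i => e.symm (Sum.inr i))
    (O := (obs 0).region) ⟨isPreconnected_closedRegion _, ?_, ?_, ?_, ?_, ?_, ?_⟩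
  · exact fun i j hij => adj _ _ (by simpa)
  · exact fun i j hij => nadj _ _ (by simpa) (by simp)
  · exact fun i j hij => nadj _ _ (by simpa) (by simp)
  · exact fun i => nadj _ _ (by simp) (by simp)
  · exact fun i j k hij => gp _ _ _ (by simpa) (by simp) (by simp)
  · exact fun i j k hij => gp _ _ _ (by simpa) (by simp) (by simp)

/-! ### Polygons with integer vertices -/

/-- The point of the plane with the given integer coordinates. -/
noncomputable def pt (v : ℤ × ℤ) : Plane := !₂[(v.1 : ℝ), (v.2 : ℝ)]

lemma pt_injective : Function.Injective pt := by
  intro u v h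
  have h0 := congrArg (fun z : Plane => z 0) h
  have h1 := congrArg (fun z : Plane => z 1) h
  simp only [pt] at h0 h1
  exact Prod.ext (by simpa using h0) (by simpa using h1)

/-- The computable counterpart of `orient` for integer coordinates. -/
def orientInt (a b c : ℤ × ℤ) : ℤ :=
  (b.1 - a.1) * (c.2 - a.2) - (b.2 - a.2) * (c.1 - a.1)

lemma orient_pt (a b c : ℤ × ℤ) : orient (pt a) (pt b) (pt c) = orientInt a b c := by
  simp [orient, orientInt, pt]

/-- The segments `a b` and `c d` are disjoint because one of them lies strictly on one side of the
line through the other. For points in general position this is the only way to be disjoint. -/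
abbrev Apart (a b c d : ℤ × ℤ) : Prop :=
  0 < orientInt a b c * orientInt a b d ∨ 0 < orientInt c d a * orientInt c d b

/-- The segments `a b` and `c d` cross. -/
abbrev Cross (a b c d : ℤ × ℤ) : Prop :=
  orientInt a b c * orientInt a b d < 0 ∧ orientInt c d a * orientInt c d b < 0

lemma disjoint_segment_of_mul_pos {a b c d : Plane} (h : 0 < orient a b c * orient a b d) :
    Disjoint (segment ℝ a b) (segment ℝ c d) := by
  rw [Set.disjoint_left]
  intro z hab hcd
  obtain ⟨s, t, -, -, -, -, e⟩ := orient_of_mem_segment a b hab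
  rw [orient_self_right, orient_self_left, mul_zero, mul_zero, add_zero] at e
  obtain ⟨s, t, hs, ht, hst, -, e'⟩ := orient_of_mem_segment a b hcd
  rw [e] at e'
  have h1 : 0 = s * orient a b c ^ 2 + t * (orient a b c * orient a b d) := by
    linear_combination orient a b c * e'
  have h2 : orient a b c ≠ 0 := fun h0 => by simp [h0] at h
  have h3 : 0 < orient a b c ^ 2 := by positivity
  rcases hs.eq_or_lt with rfl | hs
  · obtain rfl : t = 1 := by linarith
    linarith
  · nlinarith [mul_pos hs h3, mul_nonneg ht h.le]

lemma Apart.disjoint {a b c d : ℤ × ℤ} (h : Apart a b c d) :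
    Disjoint (segment ℝ (pt a) (pt b)) (segment ℝ (pt c) (pt d)) := by
  rcases h with h | h
  · apply disjoint_segment_of_mul_pos
    rw [orient_pt, orient_pt]; exact_mod_cast h
  · refine (disjoint_segment_of_mul_pos ?_).symm
    rw [orient_pt, orient_pt]; exact_mod_cast h

lemma Cross.inter_nonempty {a b c d : ℤ × ℤ} (h : Cross a b c d) :
    (segment ℝ (pt a) (pt b) ∩ segment ℝ (pt c) (pt d)).Nonempty := by
  obtain ⟨x, h₁, h₂⟩ := exists_mem_openSegment_of_mul_neg (a := pt a) (b := pt b) (c := pt c)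
    (d := pt d) (by rw [orient_pt, orient_pt]; exact_mod_cast h.1)
    (by rw [orient_pt, orient_pt]; exact_mod_cast h.2)
  exact ⟨x, openSegment_subset_segment _ _ _ h₁, openSegment_subset_segment _ _ _ h₂⟩

/-- Two segments with a common endpoint that are not collinear meet only in that endpoint. -/
lemma segment_inter_segment_subset {a b c : Plane} (h : orient a b c ≠ 0) :
    segment ℝ a b ∩ segment ℝ b c ⊆ {b} := by
  rintro z ⟨hab, hbc⟩
  obtain ⟨s, t, -, -, -, -, e⟩ := orient_of_mem_segment a b hab
  rw [orient_self_right, orient_self_left, mul_zero, mul_zero, add_zero] at e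
  obtain ⟨s, t, -, -, hst, rfl, e'⟩ := orient_of_mem_segment a b hbc
  rw [e, orient_self_right, mul_zero, zero_add] at e'
  obtain rfl : t = 0 := by simpa [h] using e'.symm
  obtain rfl : s = 1 := by linarith
  simp

/-- The polygon with the given integer vertices. -/
noncomputable def intPolygon {n : ℕ} (v : Fin n → ℤ × ℤ) : Polygon Plane n :=
  ⟨fun i => pt (v i)⟩

lemma edgeSet_intPolygon {n : ℕ} [NeZero n] (v : Fin n → ℤ × ℤ) (i : Fin n) :
    (intPolygon v).edgeSet ℝ i = segment ℝ (pt (v i)) (pt (v (i + 1))) := by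
  rw [edgeSet_eq_segment, finRotate_apply]; rfl

lemma isSimplePolygon_intPolygon {n : ℕ} [NeZero n] {v : Fin n → ℤ × ℤ} (hn : 3 ≤ n)
    (hinj : Function.Injective v)
    (hadj : ∀ i, orientInt (v i) (v (i + 1)) (v (i + 1 + 1)) ≠ 0)
    (hapart : ∀ i j, i ≠ j → j ≠ i + 1 → i ≠ j + 1 →
      Apart (v i) (v (i + 1)) (v j) (v (j + 1))) :
    IsSimplePolygon (intPolygon v) where
  three_le := hn
  injective := pt_injective.comp hinj
  edges_inter := by
    intro i j hij
    have key : ∀ i, (intPolygon v).edgeSet ℝ i ∩ (intPolygon v).edgeSet ℝ (i + 1) ⊆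
        {pt (v (i + 1))} := by
      intro i
      rw [edgeSet_intPolygon, edgeSet_intPolygon]
      apply segment_inter_segment_subset
      rw [orient_pt]; exact_mod_cast hadj i
    simp only [finRotate_apply]
    by_cases h1 : j = i + 1
    · subst h1
      intro z hz
      obtain rfl := key i hz
      simp [intPolygon]
    by_cases h2 : i = j + 1
    · subst h2
      intro z hz
      obtain rfl := key j hz.symm
      simp [intPolygon]
    intro z hz
    rw [edgeSet_intPolygon, edgeSet_intPolygon] at hz
    exact absurd rfl ((hapart i j hij h1 h2).disjoint.ne_of_mem hz.1 hz.2)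

lemma disjoint_boundary_intPolygon {n : ℕ} [NeZero n] {v : Fin n → ℤ × ℤ} {a b : ℤ × ℤ}
    (h : ∀ i, Apart a b (v i) (v (i + 1))) :
    Disjoint (segment ℝ (pt a) (pt b)) ((intPolygon v).boundary ℝ) := by
  rw [Polygon.boundary, Set.disjoint_iUnion_right]
  intro i
  rw [edgeSet_intPolygon]
  exact (h i).disjoint

lemma not_disjoint_closedRegion_intPolygon {n : ℕ} [NeZero n] {v : Fin n → ℤ × ℤ} {a b : ℤ × ℤ}
    (h : ∃ i, Cross a b (v i) (v (i + 1))) :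
    ¬ Disjoint (segment ℝ (pt a) (pt b)) (closedRegion (intPolygon v)) := by
  obtain ⟨i, hi⟩ := h
  obtain ⟨x, h₁, h₂⟩ := hi.inter_nonempty
  rw [← edgeSet_intPolygon] at h₂
  exact fun hd => hd.ne_of_mem h₁ (.inl (Set.mem_iUnion_of_mem i h₂)) rfl

/-! ### Points outside of a polygon -/

/-- The exterior of a polygon contains every connected set that avoids the boundary and contains
an exterior point. -/
lemma disjoint_closedRegion_of_isPreconnected {n : ℕ} {p : Polygon Plane n} {s : Set Plane}
    (hs : IsPreconnected s) (hd : Disjoint s (p.boundary ℝ)) {x : Plane} (hxs : x ∈ s)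
    (hx : x ∉ closedRegion p) : Disjoint s (closedRegion p) := by
  have hsub := hs.subset_connectedComponentIn hxs (Set.subset_compl_iff_disjoint_right.2 hd)
  rw [Set.disjoint_left]
  rintro y hys (hy | ⟨-, hb⟩)
  · exact hd.ne_of_mem hys hy rfl
  · refine hx (.inr ⟨fun h => hd.ne_of_mem hxs h rfl, ?_⟩)
    rwa [connectedComponentIn_eq (hsub hys)]

/-- A point not higher than some height below all vertices is outside of the polygon. -/
lemma notMem_closedRegion_of_le {n : ℕ} {p : Polygon Plane n} {c : ℝ}
    (hp : ∀ i, c < p.vertices i 1) {x : Plane} (hx : x 1 ≤ c) : x ∉ closedRegion p := by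
  have hlin : IsLinearMap ℝ fun z : Plane => z 1 := ⟨fun _ _ => rfl, fun _ _ => rfl⟩
  have hconv : Convex ℝ {z : Plane | z 1 ≤ c} := convex_halfSpace_le hlin c
  have hF : p.boundary ℝ ⊆ {z : Plane | c < z 1} := by
    refine Set.iUnion_subset fun i => ?_
    rw [edgeSet_eq_segment]
    exact (convex_halfSpace_gt hlin c).segment_subset (hp _) (hp _)
  have hd : {z : Plane | z 1 ≤ c} ⊆ (p.boundary ℝ)ᶜ := fun z hz hzF =>
    lt_irrefl c (lt_of_lt_of_le (show c < z 1 from hF hzF) hz)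
  rintro (h | ⟨-, hb⟩)
  · exact hd hx h
  have hb' := hb.subset (hconv.isPreconnected.subset_connectedComponentIn hx hd)
  obtain ⟨M, hM⟩ := hb'.exists_norm_le
  have h1 : (!₂[0, -(|c| + |M| + 1)] : Plane) ∈ {z : Plane | z 1 ≤ c} := by
    simp only [Set.mem_ofPred_eq]
    have := neg_abs_le c
    have := abs_nonneg M
    simp; linarith
  have h2 := (PiLp.norm_apply_le (!₂[0, -(|c| + |M| + 1)] : Plane) 1).trans (hM _ h1)
  have h3 : |c| + |M| + 1 ≤ M := by
    rw [Real.norm_eq_abs] at h2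
    refine le_trans ?_ ((neg_le_abs _).trans h2)
    simp
  linarith [le_abs_self M, abs_nonneg c]

/-! ### A representation with two obstacles -/

/-- The points representing the vertices `b i`. -/
def left : Fin 5 → ℤ × ℤ :=
  ![(-136, 32), (-124, 16), (-120, 0), (-124, -16), (-136, -32)]

/-- The points representing the vertices `r i`, the reflections of the points `left i` in the
origin. -/
def right : Fin 5 → ℤ × ℤ :=
  ![(136, -32), (124, -16), (120, 0), (124, 16), (136, 32)]

/-- The vertices of an arch-shaped obstacle around the drawing, which blocks the pairs of vertices
in the same class. -/
def arch : Fin 13 → ℤ × ℤ :=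
  ![(-128, -24), (-121, -8), (-121, 8), (-128, 24), (-160, 36), (160, 36), (128, 24), (121, 8),
    (121, -8), (128, -24), (200, -28), (0, 400), (-200, -28)]

/-- The vertices of a small triangle around the origin, which blocks the removed matching. -/
def core : Fin 3 → ℤ × ℤ :=
  ![(-3, -2), (2, -2), (1, 3)]

/-- All points and corners of the representation. -/
def allPoints : List (ℤ × ℤ) :=
  List.ofFn left ++ List.ofFn right ++ List.ofFn arch ++ List.ofFn core

lemma orientInt_ne_zero : ∀ a ∈ allPoints, ∀ b ∈ allPoints, a ≠ b → ∀ c ∈ allPoints,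
    b ≠ c → a ≠ c → orientInt a b c ≠ 0 := by
  decide +kernel

lemma isSimplePolygon_arch : IsSimplePolygon (intPolygon arch) :=
  isSimplePolygon_intPolygon (by norm_num) (by decide +kernel) (by decide +kernel)
    (by decide +kernel)

lemma isSimplePolygon_core : IsSimplePolygon (intPolygon core) :=
  isSimplePolygon_intPolygon (by norm_num) (by decide +kernel) (by decide +kernel)
    (by decide +kernel)

/-- A polygon lying above `left 4` whose boundary avoids all edges of the drawing has the whole
drawing in its exterior. -/
lemma disjoint_closedRegion_of_apart {n : ℕ} [NeZero n] {v : Fin n → ℤ × ℤ}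
    (hlow : ∀ i, -32 < (v i).2)
    (h : ∀ i j, i ≠ j → ∀ k, Apart (left i) (right j) (v k) (v (k + 1))) {i j : Fin 5}
    (hij : i ≠ j) :
    Disjoint (segment ℝ (pt (left i)) (pt (right j))) (closedRegion (intPolygon v)) := by
  have lr : ∀ i j, i ≠ j → pt (left i) ∉ closedRegion (intPolygon v) →
      Disjoint (segment ℝ (pt (left i)) (pt (right j))) (closedRegion (intPolygon v)) :=
    fun i j hij hi => disjoint_closedRegion_of_isPreconnected (convex_segment _ _).isPreconnected
      (disjoint_boundary_intPolygon (h i j hij)) (left_mem_segment ℝ _ _) hi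
  have rl : ∀ i j, i ≠ j → pt (right j) ∉ closedRegion (intPolygon v) →
      Disjoint (segment ℝ (pt (left i)) (pt (right j))) (closedRegion (intPolygon v)) :=
    fun i j hij hi => disjoint_closedRegion_of_isPreconnected (convex_segment _ _).isPreconnected
      (disjoint_boundary_intPolygon (h i j hij)) (right_mem_segment ℝ _ _) hi
  have h4 : pt (left 4) ∉ closedRegion (intPolygon v) := by
    refine notMem_closedRegion_of_le (c := -32) (fun i => ?_) ?_
    · simp only [intPolygon, pt]
      simpa using (Int.cast_lt (R := ℝ)).2 (hlow i)
    · simp [pt, left]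
  have hr : ∀ j, j ≠ 4 → pt (right j) ∉ closedRegion (intPolygon v) := fun j hj hm =>
    (lr 4 j hj.symm h4).ne_of_mem (right_mem_segment ℝ _ _) hm rfl
  have hl : pt (left i) ∉ closedRegion (intPolygon v) := by
    obtain ⟨k, hk, hik⟩ : ∃ k : Fin 5, k ≠ 4 ∧ i ≠ k := by
      clear * -; revert i; decide
    exact fun hm => (rl i k hik (hr k hk)).ne_of_mem (left_mem_segment ℝ _ _) hm rfl
  exact lr i j hij hl

/-- The two obstacles. -/
noncomputable def obstacles : Fin 2 → PolygonalObstacle :=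
  ![⟨13, intPolygon arch, isSimplePolygon_arch⟩, ⟨3, intPolygon core, isSimplePolygon_core⟩]

/-- The point representing a vertex of `K*_{5,5}`. -/
def place : Fin 5 ⊕ Fin 5 → ℤ × ℤ := Sum.elim left right

lemma place_injective : Function.Injective place := by decide +kernel

lemma region_obstacles_zero : (obstacles 0).region = closedRegion (intPolygon arch) := rfl

lemma region_obstacles_one : (obstacles 1).region = closedRegion (intPolygon core) := rfl

/-- Two points see each other exactly if the vertices that they represent are adjacent. -/
lemma visible_iff {u v : Fin 5 ⊕ Fin 5} (huv : u ≠ v) :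
    (∀ k, Disjoint (segment ℝ (pt (place u)) (pt (place v))) (obstacles k).region) ↔
      (kStar 5).Adj u v := by
  rw [Fin.forall_fin_two, region_obstacles_zero, region_obstacles_one]
  have edge : ∀ i j : Fin 5, i ≠ j →
      Disjoint (segment ℝ (pt (left i)) (pt (right j))) (closedRegion (intPolygon arch)) ∧
      Disjoint (segment ℝ (pt (left i)) (pt (right j))) (closedRegion (intPolygon core)) :=
    fun i j hij =>
      ⟨disjoint_closedRegion_of_apart (by decide +kernel) (by decide +kernel) hij,
        disjoint_closedRegion_of_apart (by decide +kernel) (by decide +kernel) hij⟩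
  have ll : ∀ i j : Fin 5, i ≠ j → ∃ k, Cross (left i) (left j) (arch k) (arch (k + 1)) := by
    decide +kernel
  have rr : ∀ i j : Fin 5, i ≠ j → ∃ k, Cross (right i) (right j) (arch k) (arch (k + 1)) := by
    decide +kernel
  have matching : ∀ i : Fin 5, ∃ k, Cross (left i) (right i) (core k) (core (k + 1)) := by
    decide +kernel
  have cross : ∀ i j : Fin 5,
      (Disjoint (segment ℝ (pt (left i)) (pt (right j))) (closedRegion (intPolygon arch)) ∧
      Disjoint (segment ℝ (pt (left i)) (pt (right j))) (closedRegion (intPolygon core))) ↔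
      i ≠ j := by
    refine fun i j => ⟨?_, edge i j⟩
    rintro h rfl
    exact not_disjoint_closedRegion_intPolygon (matching i) h.2
  rcases u with i | i <;> rcases v with j | j
  · simp only [not_kStar_adj_inl_inl, iff_false]
    exact fun h => not_disjoint_closedRegion_intPolygon (ll i j (by simpa using huv)) h.1
  · simpa [place] using cross i j
  · rw [segment_symm]
    simpa [place, eq_comm] using cross j i
  · simp only [not_kStar_adj_inr_inr, iff_false]
    exact fun h => not_disjoint_closedRegion_intPolygon (rr i j (by simpa using huv)) h.1

lemma corners_obstacles_subset (k : Fin 2) : (obstacles k).corners ⊆ pt '' {v | v ∈ allPoints} := by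
  revert k
  rw [Fin.forall_fin_two]
  constructor
  · rintro _ ⟨i, rfl⟩
    exact ⟨arch i, (by decide : ∀ i, arch i ∈ allPoints) i, rfl⟩
  · rintro _ ⟨i, rfl⟩
    exact ⟨core i, (by decide : ∀ i, core i ∈ allPoints) i, rfl⟩

theorem hasObstacleRepresentation_two : HasObstacleRepresentation (kStar 5) 2 := by
  have hinj : Function.Injective fun u => pt (place u) := pt_injective.comp place_injective
  refine ⟨Set.range fun u => pt (place u), obstacles, Set.finite_range _, ?_, ⟨?_⟩⟩
  · have sub : (Set.range fun u => pt (place u)) ∪ ⋃ k, (obstacles k).corners ⊆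
        pt '' {v | v ∈ allPoints} := by
      refine Set.union_subset ?_ (Set.iUnion_subset corners_obstacles_subset)
      rintro _ ⟨i | i, rfl⟩
      · exact ⟨left i, (by decide : ∀ i, left i ∈ allPoints) i, rfl⟩
      · exact ⟨right i, (by decide : ∀ i, right i ∈ allPoints) i, rfl⟩
    intro a ha b hb c hc hab hbc hac hcol
    obtain ⟨a, ha', rfl⟩ := sub ha
    obtain ⟨b, hb', rfl⟩ := sub hb
    obtain ⟨c, hc', rfl⟩ := sub hc
    rw [collinear_iff_orient_eq_zero, orient_pt] at hcol
    exact orientInt_ne_zero a ha' b hb' (fun h => hab (congrArg pt h)) c hc'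
      (fun h => hbc (congrArg pt h)) (fun h => hac (congrArg pt h)) (by exact_mod_cast hcol)
  · refine RelIso.symm ⟨Equiv.ofInjective _ hinj, fun {u v} => ?_⟩
    by_cases huv : u = v
    · subst huv; simp
    · rw [← visible_iff huv]
      exact and_iff_right fun h => huv ((Equiv.ofInjective _ hinj).injective h)

end KStar

theorem theorem1 : obstacleNumber (kStar 5) = 2 := by
  refine le_antisymm (iInf₂_le 2 KStar.hasObstacleRepresentation_two) (le_iInf₂ fun h hh => ?_)
  match h, hh with
  | 0, hh => exact absurd hh KStar.not_hasObstacleRepresentation_zero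
  | 1, hh => exact absurd hh KStar.not_hasObstacleRepresentation_one
  | h + 2, _ => exact_mod_cast Nat.le_add_left 2 h
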